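/- For finite simple graphs $G$ and $H$, the tensor product $G\times H$ is the graph on $V(G)\times V(H)$ in which $(g_1,h_1)$ and $(g_2,h_2)$ are adjacent if and only if $g_1g_2\in E(G)$ and $h_1h_2\in E(H)$. The Poljak--Rödl function is $$f(k)=\min\{\chi(G\times H) : G,H \text{ finite simple graphs with } \chi(G)\ge k \text{ and } \chi(H)\ge k\}.$$ **Theorem.** There is an absolute constant $\delta\ge 10^{-9}$ with the following two properties. 1. For all sufficiently large integers $c$ there exist finite simple graphs $G$ and $H$ with $\chi(G)\ge(1+\delta)c$ and $\chi(H)\ge(1+\delta)c$, and yet $\chi(G\times H)\le c$. 2. For all sufficiently large integers $k$, the Poljak--Rödl function satisfies $f(k)\le(1-\delta)k$. In particular, Hedetniemi's conjecture, that $\chi(G\times H)=\min\{\chi(G),\chi(H)\}$ for all finite graphs $G$ and $H$, fails by a constant factor. -/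

import Mathlib

/-- The tensor (categorical) product `G × H` of two simple graphs: `(g₁, h₁)` and `(g₂, h₂)` are
adjacent iff `g₁ ∼ g₂` in `G` and `h₁ ∼ h₂` in `H`. -/
def SimpleGraph.tensorProduct {V W : Type*} (G : SimpleGraph V) (H : SimpleGraph W) :
    SimpleGraph (V × W) where
  Adj x y := G.Adj x.1 y.1 ∧ H.Adj x.2 y.2
  symm := ⟨fun _ _ h => ⟨h.1.symm, h.2.symm⟩⟩
  loopless := ⟨fun x h => G.loopless.irrefl x.1 h.1⟩

/-- The set of all values `χ(G × H)`, where `G` and `H` run over the finite simple graphs with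
`χ(G) ≥ k` and `χ(H) ≥ k`. -/
def poljakRodlSet (k : ℕ) : Set ℕ :=
  {m | ∃ (V W : Type) (_ : Finite V) (_ : Finite W) (G : SimpleGraph V) (H : SimpleGraph W),
    (k : ℕ∞) ≤ G.chromaticNumber ∧ (k : ℕ∞) ≤ H.chromaticNumber ∧
      (G.tensorProduct H).chromaticNumber = (m : ℕ∞)}

/-- The set is never empty (both factors can be the complete graph on `k` vertices), so that the
infimum below is a minimum. -/
theorem poljakRodlSet_nonempty (k : ℕ) : (poljakRodlSet k).Nonempty := by
  have hc : ((⊤ : SimpleGraph (Fin k)).tensorProduct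
      (⊤ : SimpleGraph (Fin k))).chromaticNumber ≠ ⊤ :=
    SimpleGraph.chromaticNumber_ne_top_iff_exists.2
      ⟨_, SimpleGraph.colorable_of_fintype _⟩
  obtain ⟨m, hm⟩ := ENat.ne_top_iff_exists.1 hc
  exact ⟨m, Fin k, Fin k, inferInstance, inferInstance, ⊤, ⊤, by simp, by simp, hm.symm⟩

/-- The Poljak–Rödl function `f(k) = min χ(G × H)`, the minimum over all finite simple graphs
`G`, `H` with `χ(G) ≥ k` and `χ(H) ≥ k`. -/
noncomputable def poljakRodl (k : ℕ) : ℕ := sInf (poljakRodlSet k)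

/-!
Fix a triangle-free graph `Γ` on `p` vertices whose independent sets have size at most `a`, with
`p / a > 4`; here `Γ` is a circulant graph with `p = 35`, `a = 8`. Let `G` be the blow-up of `Γ` in
which every vertex becomes a clique of size `q` (and every edge a complete bipartite graph), and let
`H` be the exponential graph of `G` over a set `K` of `c` colours: its vertices are the maps from
the vertices of `G` to `K`, and distinct maps `f`, `g` are adjacent when `f x ≠ g y` for each edge
`xy` of `G`. Evaluation `(x, f) ↦ f x` colours `G × H` properly with `c` colours
(`chromaticNumber_tensorProduct_exponential_le`). A colour class of `G` has at most `a` vertices,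
so `χ(G) ≥ pq / a` (`card_mul_card_le_of_colorable_cliqueBlowup`).

To bound `χ(H)` from below, split `K` into `2q` local colours and a set `T` of `m = c - 2q` others,
and let `C` be a proper colouring of `H` by a set `ι` of colours.

* Maps `f : V(Γ) → T` lift to vertices of `H` constant on each clique of `G`. Two lifted maps with
  the same `C`-colour share a value. Call a triple `(v, b, s)` popular if the maps with `C`-colour
  `s` and value `b` at `v` are so generic that their values away from `v` can avoid any `p`
  prescribed elements of `T`. For an unpopular triple there are only `O(m ^ (p - 2))` such maps.
  Two members of a class share a value, so a class contains only `O(m ^ (p - 2))` maps all of whose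
  values are unpopular for that class. If each vertex `v` had a proportion of `T` of values `b`
  that are in no popular triple `(v, b, s)`, there would be a proportion of all `m ^ p` maps built
  from such values, too many for `O(m)` classes (`exists_vertex_card_unpopular_lt`). Hence there is
  a vertex `v` for which nearly all `b` are popular with some `s`, and different `b` have different
  `s` (`IsPopular.value_unique`). This gives about `m` elements of `ι`.
* For `t` in `T` let `μ t` be the map using the first `q` local colours on the clique over `v`, the
  other `q` over each neighbour of `v`, and `t` elsewhere. As `Γ` is triangle-free, these `m` maps
  form a clique of `H`. A map with `b` at `v` and without the value `t` elsewhere is adjacent to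
  `μ t`, so no `μ t` has the colour `s` of a popular triple `(v, b, s)`. This gives `m` further
  elements of `ι`.

So `χ(H) ≥ (2 - o(1)) (c - 2q)` (`lt_of_coloring_exponential_cliqueBlowup`). For `q` close to
`0.24 c`, both `2 (c - 2q) = 1.04 c` and `35 q / 8 = 1.05 c` exceed `c` by a constant factor.
-/

open Finset

/-! ### Exponential graphs and blow-ups -/

namespace SimpleGraph

variable {V : Type*}

/-- The exponential graph `K ^ G`: the vertices are all maps from the vertices of `G` to `K`. A proper
colouring `f` of `G` would be adjacent to itself; that loop is dropped, so that the result is always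
a simple graph. -/
def exponential (G : SimpleGraph V) (K : Type*) : SimpleGraph (V → K) where
  Adj f g := f ≠ g ∧ ∀ x y, G.Adj x y → f x ≠ g y
  symm := ⟨fun _ _ h => ⟨h.1.symm, fun x y hxy e => h.2 y x hxy.symm e.symm⟩⟩
  loopless := ⟨fun _ h => h.1 rfl⟩

/-- The lexicographic product of `G` with the complete graph on `Q`: each vertex of `G` is replaced by
a clique indexed by `Q`, and each edge by all edges between the two cliques. -/
def cliqueBlowup (G : SimpleGraph V) (Q : Type*) : SimpleGraph (V × Q) where
  Adj a b := G.Adj a.1 b.1 ∨ (a.1 = b.1 ∧ a.2 ≠ b.2)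
  symm := ⟨fun _ _ h => h.imp (fun h => h.symm) fun h => ⟨h.1.symm, h.2.symm⟩⟩
  loopless := ⟨fun a h => h.elim (G.loopless.irrefl a.1) fun h => h.2 rfl⟩

theorem chromaticNumber_tensorProduct_exponential_le (G : SimpleGraph V) (K : Type*) [Fintype K] :
    (G.tensorProduct (G.exponential K)).chromaticNumber ≤ (Fintype.card K : ℕ∞) := by
  have C : (G.tensorProduct (G.exponential K)).Coloring K :=
    Coloring.mk (fun x => x.2 x.1) fun {a b} h => h.2.2 _ _ h.1
  exact C.colorable.chromaticNumber_le

/-- A colour class of the blow-up meets each clique at most once, so it projects injectively to an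
independent set of `G`. -/
theorem card_mul_card_le_of_colorable_cliqueBlowup [Fintype V] {Q : Type*} [Fintype Q]
    {G : SimpleGraph V} {a n : ℕ} (ha : ∀ s : Finset V, G.IsIndepSet s → s.card ≤ a)
    (hn : (G.cliqueBlowup Q).Colorable n) : Fintype.card V * Fintype.card Q ≤ a * n := by
  classical
  obtain ⟨C⟩ := hn
  have hclass (k : Fin n) : #{z : V × Q | C z = k} ≤ a := by
    have hinj : Set.InjOn Prod.fst (({z : V × Q | C z = k} : Finset (V × Q)) : Set (V × Q)) := by
      intro z hz w hw e
      simp only [coe_filter, mem_univ, true_and, Set.mem_ofPred_eq] at hz hw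
      by_contra hne
      refine C.valid (v := z) (w := w) (Or.inr ⟨e, fun e' => hne (Prod.ext e e')⟩) (hz.trans hw.symm)
    rw [← card_image_of_injOn hinj]
    refine ha _ ?_
    intro x hx y hy _ hxy
    simp only [coe_image, coe_filter, mem_univ, true_and, Set.mem_image, Set.mem_ofPred_eq] at hx hy
    obtain ⟨z, hz, rfl⟩ := hx
    obtain ⟨w, hw, rfl⟩ := hy
    exact C.valid (v := z) (w := w) (Or.inl hxy) (hz.trans hw.symm)
  calc Fintype.card V * Fintype.card Q = #(univ : Finset (V × Q)) := by simp
    _ ≤ a * #(univ : Finset (Fin n)) :=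
        card_le_mul_card_image_of_maps_to (fun _ _ => mem_univ _) a fun k _ => hclass k
    _ = a * n := by simp

end SimpleGraph

/-! ### Popular values in an intersecting partition of `V → T` -/

section Popular

variable {V T ι : Type*} [Fintype V]

/-- The value `b` at the vertex `v` is popular for the class `s` of `Φ`: some map in the class takes
the value `b` at `v`, and its values at the other vertices can be made to avoid any given set of at
most `|V|` elements. The bound `|V|` allows the image of another map as that set. -/
def IsPopular (Φ : (V → T) → ι) (v : V) (b : T) (s : ι) : Prop :=
  ∀ F : Finset T, F.card ≤ Fintype.card V → ∃ f, Φ f = s ∧ f v = b ∧ ∀ x ≠ v, f x ∉ F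

/-- If maps in the same class share a value, a class is popular with at most one `b`: a generic map
with value `b` at `v` and a generic one with value `b'` at `v'` can share a value only if
`b = b'`. -/
theorem IsPopular.value_unique {Φ : (V → T) → ι}
    (hΦ : ∀ f g, Φ f = Φ g → ∃ x y, f x = g y) {v v' : V} {b b' : T} {s : ι}
    (h : IsPopular Φ v b s) (h' : IsPopular Φ v' b' s) : b = b' := by
  classical
  obtain ⟨g, hgs, hgv, hg⟩ := h' {b} (by
    rw [card_singleton]; exact Fintype.card_pos_iff.2 ⟨v⟩)
  obtain ⟨f, hfs, hfv, hf⟩ := h (univ.image g) card_image_le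
  obtain ⟨x, y, hxy⟩ := hΦ f g (hfs.trans hgs.symm)
  have hx : x = v := by
    by_contra hx
    exact hf x hx (hxy ▸ mem_image_of_mem g (mem_univ y))
  have hy : y = v' := by
    by_contra hy
    exact hg y hy (by rw [← hxy, hx, hfv]; exact mem_singleton_self b)
  rw [← hfv, ← hgv, ← hx, ← hy, hxy]

variable [DecidableEq V] [Fintype T] [DecidableEq T]

/-- At most `|T| ^ (|V| - 2)` maps have two prescribed values. The factor `|T| ^ 2` on the left avoids
a truncated exponent. -/
theorem card_filter_two_values_mul_le {v x : V} (hx : x ≠ v) (b t : T) :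
    #{f : V → T | f v = b ∧ f x = t} * Fintype.card T ^ 2 ≤ Fintype.card T ^ Fintype.card V := by
  have h : #(({f : V → T | f v = b ∧ f x = t} : Finset (V → T)) ×ˢ (univ : Finset (T × T))) ≤
      #(univ : Finset (V → T)) := by
    -- Overwriting the two prescribed values by arbitrary ones loses no information.
    refine card_le_card_of_injOn
      (fun z => Function.update (Function.update z.1 v z.2.1) x z.2.2) (fun _ _ => mem_univ _) ?_
    rintro ⟨f, s, s'⟩ hf ⟨g, r, r'⟩ hg e
    simp only [coe_product, coe_filter, mem_univ, true_and, coe_univ, Set.mem_prod,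
      Set.mem_ofPred_eq, Set.mem_univ, and_true] at hf hg
    have hs' : s' = r' := by simpa using congrFun e x
    have hs : s = r := by simpa [Function.update_of_ne hx.symm] using congrFun e v
    have hfg : f = g := by
      funext y
      by_cases hyx : y = x
      · rw [hyx, hf.2, hg.2]
      by_cases hyv : y = v
      · rw [hyv, hf.1, hg.1]
      simpa [Function.update_of_ne hyx, Function.update_of_ne hyv] using congrFun e y
    rw [hs', hs, hfg]
  simpa [card_product, sq] using h

theorem card_filter_mul_le_of_not_isPopular [DecidableEq ι] {Φ : (V → T) → ι} {v : V} {b : T}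
    {s : ι} (h : ¬ IsPopular Φ v b s) :
    #{f : V → T | Φ f = s ∧ f v = b} * Fintype.card T ^ 2 ≤
      Fintype.card V ^ 2 * Fintype.card T ^ Fintype.card V := by
  simp only [IsPopular, not_forall, not_exists, not_and] at h
  obtain ⟨F, hF, h⟩ := h
  have hsub : ({f : V → T | Φ f = s ∧ f v = b} : Finset (V → T)) ⊆
      ((univ.erase v) ×ˢ F).biUnion fun z => {f : V → T | f v = b ∧ f z.1 = z.2} := by
    intro f hf
    simp only [mem_filter, mem_univ, true_and] at hf
    obtain ⟨x, hx, hxF⟩ : ∃ x, x ≠ v ∧ f x ∈ F := by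
      have := h f hf.1 hf.2
      push Not at this
      simpa using this
    simp only [mem_biUnion, mem_product, mem_erase, mem_filter, mem_univ, true_and, and_true]
    exact ⟨(x, f x), ⟨hx, hxF⟩, hf.2, rfl⟩
  calc _ ≤ (∑ z ∈ (univ.erase v) ×ˢ F, #{f : V → T | f v = b ∧ f z.1 = z.2}) *
        Fintype.card T ^ 2 := Nat.mul_le_mul_right _ ((card_le_card hsub).trans card_biUnion_le)
    _ ≤ ∑ z ∈ (univ.erase v) ×ˢ F, Fintype.card T ^ Fintype.card V := by
        rw [sum_mul]
        refine sum_le_sum fun z hz => card_filter_two_values_mul_le ?_ _ _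
        exact (mem_erase.1 (mem_product.1 hz).1).1
    _ = #(univ.erase v) * #F * Fintype.card T ^ Fintype.card V := by
        rw [sum_const, card_product, smul_eq_mul]
    _ ≤ _ := by
        rw [sq]
        gcongr
        exact card_le_univ _

/-- Only few maps take nothing but unpopular values: one such map `f₀` in a class forces every other
one in that class to have an unpopular value taken from the image of `f₀`. -/
theorem prod_card_unpopular_mul_le [Fintype ι] {Φ : (V → T) → ι}
    (hΦ : ∀ f g, Φ f = Φ g → ∃ x y, f x = g y) (U : V → Finset T)
    (hU : ∀ v, ∀ b ∈ U v, ∀ s, ¬ IsPopular Φ v b s) :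
    (∏ v, #(U v)) * Fintype.card T ^ 2 ≤
      Fintype.card ι * Fintype.card V ^ 4 * Fintype.card T ^ Fintype.card V := by
  classical
  have hclass (s : ι) : #{f ∈ Fintype.piFinset U | Φ f = s} * Fintype.card T ^ 2 ≤
      Fintype.card V ^ 4 * Fintype.card T ^ Fintype.card V := by
    rcases ({f ∈ Fintype.piFinset U | Φ f = s} : Finset (V → T)).eq_empty_or_nonempty with
      h | ⟨f₀, h₀⟩
    · simp [h]
    rw [mem_filter] at h₀
    let I : Finset (V × V) := {z | f₀ z.2 ∈ U z.1}
    have hsub : ({f ∈ Fintype.piFinset U | Φ f = s} : Finset (V → T)) ⊆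
        I.biUnion fun z => {f : V → T | Φ f = s ∧ f z.1 = f₀ z.2} := by
      intro f hf
      rw [mem_filter, Fintype.mem_piFinset] at hf
      obtain ⟨x, y, hxy⟩ := hΦ f f₀ (hf.2.trans h₀.2.symm)
      simp only [I, mem_biUnion, mem_filter, mem_univ, true_and]
      exact ⟨(x, y), hxy ▸ hf.1 x, hf.2, hxy⟩
    calc _ ≤ (∑ z ∈ I, #{f : V → T | Φ f = s ∧ f z.1 = f₀ z.2}) * Fintype.card T ^ 2 :=
          Nat.mul_le_mul_right _ ((card_le_card hsub).trans card_biUnion_le)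
      _ ≤ ∑ z ∈ I, Fintype.card V ^ 2 * Fintype.card T ^ Fintype.card V := by
          rw [sum_mul]
          refine sum_le_sum fun z hz => card_filter_mul_le_of_not_isPopular (hU z.1 _ ?_ s)
          simpa [I] using hz
      _ = #I * (Fintype.card V ^ 2 * Fintype.card T ^ Fintype.card V) := by
          rw [sum_const, smul_eq_mul]
      _ ≤ (Fintype.card V * Fintype.card V) *
            (Fintype.card V ^ 2 * Fintype.card T ^ Fintype.card V) := by
          gcongr
          exact (card_le_univ _).trans_eq (Fintype.card_prod _ _)
      _ = _ := by ring
  rw [← Fintype.card_piFinset, card_eq_sum_card_fiberwise (f := Φ) (t := univ)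
    (fun _ _ => mem_univ _), sum_mul]
  refine (sum_le_sum fun s _ => hclass s).trans_eq ?_
  rw [sum_const, smul_eq_mul, card_univ, mul_assoc]

/-- If `T` is large compared with the number of classes, some vertex has at most a proportion `1 / N`
of unpopular values. -/
theorem exists_vertex_card_unpopular_lt [Fintype ι] {Φ : (V → T) → ι}
    (hΦ : ∀ f g, Φ f = Φ g → ∃ x y, f x = g y) (U : V → Finset T)
    (hU : ∀ v, ∀ b ∈ U v, ∀ s, ¬ IsPopular Φ v b s) {N : ℕ}
    (hT : N ^ Fintype.card V * (Fintype.card ι * Fintype.card V ^ 4) < Fintype.card T ^ 2) :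
    ∃ v, N * #(U v) < Fintype.card T := by
  by_contra! hcon
  have hpos : 0 < Fintype.card T := by
    rcases Nat.eq_zero_or_pos (Fintype.card T) with h | h
    · simp [h] at hT
    · exact h
  have hprod : Fintype.card T ^ Fintype.card V ≤ N ^ Fintype.card V * ∏ v, #(U v) := by
    have := prod_le_prod' (s := univ) fun v _ => hcon v
    simpa [prod_mul_distrib] using this
  have hkey : Fintype.card T ^ Fintype.card V * Fintype.card T ^ 2 ≤
      Fintype.card T ^ Fintype.card V *
        (N ^ Fintype.card V * (Fintype.card ι * Fintype.card V ^ 4)) :=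
    calc _ ≤ (N ^ Fintype.card V * ∏ v, #(U v)) * Fintype.card T ^ 2 := by gcongr
      _ = N ^ Fintype.card V * ((∏ v, #(U v)) * Fintype.card T ^ 2) := by ring
      _ ≤ N ^ Fintype.card V *
          (Fintype.card ι * Fintype.card V ^ 4 * Fintype.card T ^ Fintype.card V) :=
        Nat.mul_le_mul_left _ (prod_card_unpopular_mul_le hΦ U hU)
      _ = _ := by ring
  exact absurd (Nat.le_of_mul_le_mul_left hkey (pow_pos hpos _)) (not_le.2 hT)

end Popular

/-! ### The chromatic number of the exponential graph of a blow-up -/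

namespace SimpleGraph

section Star

variable {V Q T : Type*}

open Classical in
/-- The map on the blow-up of `G` that colours the clique over `v` with `(false, ·)`, each clique over
a neighbour of `v` with `(true, ·)`, and everything else with `t`. -/
noncomputable def starMap (G : SimpleGraph V) (v : V) (t : T) (z : V × Q) : (Bool × Q) ⊕ T :=
  if z.1 = v then Sum.inl (false, z.2) else if G.Adj v z.1 then Sum.inl (true, z.2) else Sum.inr t

/-- The maps `starMap v t`, for varying `t`, form a clique. Triangle-freeness is needed because all
cliques over neighbours of `v` share the same colours. -/
theorem exponential_adj_starMap [Nonempty Q] {G : SimpleGraph V} (hG : G.CliqueFree 3) {v : V}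
    (hv : ∃ x, x ≠ v ∧ ¬ G.Adj v x) {t t' : T} (ht : t ≠ t') :
    ((G.cliqueBlowup Q).exponential ((Bool × Q) ⊕ T)).Adj (G.starMap v t) (G.starMap v t') := by
  classical
  refine ⟨fun e => ?_, ?_⟩
  · obtain ⟨x, hx, hvx⟩ := hv
    have := congrFun e (x, Classical.arbitrary Q)
    simp [starMap, hx, hvx, ht] at this
  rintro ⟨x, i⟩ ⟨y, j⟩ hxy e
  have htri : ¬ (G.Adj v x ∧ G.Adj v y ∧ G.Adj x y) := fun h =>
    hG {v, x, y} (is3Clique_triple_iff.2 h)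
  simp only [cliqueBlowup] at hxy
  simp only [starMap] at e
  by_cases hx : x = v <;> by_cases hy : y = v <;> by_cases hvx : G.Adj v x <;>
    by_cases hvy : G.Adj v y <;> simp_all

/-- A lifted map avoids the local colours, so it can conflict with `starMap v t` only through the value
`t`. The value of `f` at `v` is harmless even if it is `t`, since `starMap v t` takes only local colours
at `v` and its neighbours. -/
theorem exists_eq_of_not_adj_starMap [Nonempty Q] {G : SimpleGraph V} {v : V} {t : T}
    {f : V → T}
    (h : ¬ ((G.cliqueBlowup Q).exponential ((Bool × Q) ⊕ T)).Adj
      (fun z => Sum.inr (f z.1)) (G.starMap v t)) : ∃ x ≠ v, f x = t := by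
  classical
  by_contra! hcon
  refine h ⟨fun e => ?_, ?_⟩
  · have := congrFun e (v, Classical.arbitrary Q)
    simp [starMap] at this
  rintro ⟨x, i⟩ ⟨y, j⟩ hxy e
  simp only [cliqueBlowup] at hxy
  simp only [starMap] at e
  split_ifs at e with hy hvy
  have hx : x ≠ v := by
    rintro rfl
    rcases hxy with hxy | hxy
    · exact hvy hxy
    · exact hy hxy.1.symm
  exact hcon x hx (Sum.inr_injective e)

/-- A proper colouring of the exponential graph by `ι` needs more than `(2 - 1 / N) |T|` colours, once
`|T|` is large. -/
theorem lt_of_coloring_exponential_cliqueBlowup [Fintype V] [Nonempty V] [Nonempty Q] [Fintype T]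
    {ι : Type*} [Fintype ι] {G : SimpleGraph V} (hG : G.CliqueFree 3)
    (hv : ∀ v, ∃ x, x ≠ v ∧ ¬ G.Adj v x) {N : ℕ}
    (C : ((G.cliqueBlowup Q).exponential ((Bool × Q) ⊕ T)).Coloring ι)
    (hT : N ^ Fintype.card V * (Fintype.card ι * Fintype.card V ^ 4) < Fintype.card T ^ 2) :
    N * (2 * Fintype.card T) < N * Fintype.card ι + Fintype.card T := by
  classical
  let Φ : (V → T) → ι := fun f => C fun z => Sum.inr (f z.1)
  have hΦ (f g : V → T) (hfg : Φ f = Φ g) : ∃ x y, f x = g y := by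
    by_contra! hne
    refine C.valid (v := fun z => Sum.inr (f z.1)) (w := fun z => Sum.inr (g z.1)) ⟨?_, ?_⟩ hfg
    · intro e
      have := congrFun e (Classical.arbitrary V, Classical.arbitrary Q)
      exact hne _ _ (Sum.inr_injective this)
    · exact fun x y _ e => hne _ _ (Sum.inr_injective e)
  let U : V → Finset T := fun v => {b | ∀ s, ¬ IsPopular Φ v b s}
  obtain ⟨v, hUv⟩ := exists_vertex_card_unpopular_lt hΦ U (by simp [U]) hT
  have hpop (b : ((U v)ᶜ : Finset T)) : ∃ s, IsPopular Φ v b s := by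
    have := b.2
    simpa [U] using this
  choose s hs using hpop
  -- The classes popular at `v` and those of the maps `starMap v t` are all distinct.
  have hinj : Function.Injective (Sum.elim s fun t : T => C (G.starMap v t)) := by
    refine Function.Injective.sumElim ?_ ?_ ?_
    · intro b b' e
      exact Subtype.ext ((hs b).value_unique hΦ (e ▸ hs b'))
    · intro t t' e
      by_contra ht
      exact C.valid (exponential_adj_starMap hG (hv v) ht) e
    · intro b t e
      obtain ⟨f, hfs, -, hf⟩ := hs b {t} (by
        rw [card_singleton]; exact Fintype.card_pos)
      obtain ⟨x, hx, hxt⟩ := exists_eq_of_not_adj_starMap (Q := Q) (G := G) (v := v) (t := t)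
        (f := f) fun hadj => C.valid hadj (hfs.trans e)
      exact hf x hx (mem_singleton.2 hxt)
  have hcard := Fintype.card_le_of_injective _ hinj
  rw [Fintype.card_sum, Fintype.card_coe, card_compl] at hcard
  have hle : #(U v) ≤ Fintype.card T := card_le_univ _
  have h2 : 2 * Fintype.card T ≤ Fintype.card ι + #(U v) := by omega
  calc N * (2 * Fintype.card T) ≤ N * (Fintype.card ι + #(U v)) := Nat.mul_le_mul_left _ h2
    _ = N * Fintype.card ι + N * #(U v) := mul_add _ _ _
    _ < _ := by omega

end Star

end SimpleGraph

/-! ### A triangle-free graph on 35 vertices without independent sets of size 9 -/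

section Search

variable {α : Type*}

/-- Whether `P x l'` holds for every decomposition `l = l₀ ++ x :: l'`. -/
def allTails (P : α → List α → Bool) : List α → Bool
  | [] => true
  | x :: l => P x l && allTails P l

/-- A branching search: if it returns `true`, then `l` has no sublist of length `k` that is independent
for the relation `r`. A branch is closed when fewer than `k` candidates remain. `Nat.ble` is used
because the kernel evaluates it natively. -/
def noIndepList (r : α → α → Bool) : ℕ → List α → Bool
  | 0, _ => false
  | k + 1, l => Nat.ble l.length k ||
      allTails (fun x l' => noIndepList r k (l'.filter fun y => !r x y)) l

theorem length_lt_of_noIndepList (r : α → α → Bool) (k : ℕ) : ∀ {l s : List α},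
    noIndepList r k l = true → s.Sublist l → s.Pairwise (fun x y => r x y = false) →
      s.length < k := by
  induction k with
  | zero => intro l s h; simp [noIndepList] at h
  | succ k ih =>
    intro l s h hs hp
    rw [noIndepList, Bool.or_eq_true, Nat.ble_eq] at h
    rcases h with h | h
    · have := hs.length_le
      omega
    induction hs with
    | slnil => simp
    | cons x _ ih' =>
      rw [allTails, Bool.and_eq_true] at h
      exact ih' hp h.2
    | @cons_cons s l x hs _ =>
      rw [allTails, Bool.and_eq_true] at h
      rw [List.pairwise_cons] at hp
      have hsub : s.Sublist (l.filter fun y => !r x y) := by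
        have := hs.filter fun y => !r x y
        rwa [List.filter_eq_self.2 fun y hy => by simp [hp.1 y hy]] at this
      simpa using ih h.1 hsub hp.2

end Search

/-- Adjacency in the circulant graph on `ℤ / 35` with connection set `{±1, ±7, ±11, ±16}`, as a
Boolean function. Subtraction in `Fin 35` is modulo `35`. -/
def circulantRel (a b : Fin 35) : Bool :=
  [1, 7, 11, 16, 19, 24, 28, 34].contains (a - b).val

/-- The circulant graph on `ℤ / 35` with connection set `{±1, ±7, ±11, ±16}`, which witnesses the Ramsey
bound `R(3, 9) > 35`. -/
def circulant35 : SimpleGraph (Fin 35) where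
  Adj a b := circulantRel a b = true
  symm := ⟨by unfold circulantRel; decide +kernel⟩
  loopless := ⟨by unfold circulantRel; decide +kernel⟩

theorem circulant35_cliqueFree : circulant35.CliqueFree 3 := by
  intro s hs
  obtain ⟨a, b, c, hab, hac, hbc, -⟩ := SimpleGraph.is3Clique_iff.1 hs
  -- The connection set is sum-free.
  have hsum : ∀ x y : Fin 35, [1, 7, 11, 16, 19, 24, 28, 34].contains x.val = true →
      [1, 7, 11, 16, 19, 24, 28, 34].contains y.val = true →
      [1, 7, 11, 16, 19, 24, 28, 34].contains (x + y).val = false := by decide +kernel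
  have h := hsum (a - b) (b - c) hab hbc
  rw [sub_add_sub_cancel] at h
  exact absurd hac (by simpa [circulant35, circulantRel] using h)

theorem circulant35_card_le (s : Finset (Fin 35)) (hs : circulant35.IsIndepSet s) : #s ≤ 8 := by
  have hcheck : noIndepList circulantRel 9 (List.finRange 35) = true := by decide +kernel
  have hnodup : ((List.finRange 35).filter (· ∈ s)).Nodup := (List.nodup_finRange 35).filter _
  have h := length_lt_of_noIndepList _ _ hcheck
    (List.filter_sublist (p := fun x => decide (x ∈ s))) (by
      refine (List.Nodup.pairwise_of_forall_ne hnodup ?_)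
      intro a ha b hb hab
      simp only [List.mem_filter, List.mem_finRange, true_and, decide_eq_true_eq] at ha hb
      simpa [circulant35] using hs ha hb hab)
  have hset : ((List.finRange 35).filter (· ∈ s)).toFinset = s := by ext; simp
  rw [← hset, List.toFinset_card_of_nodup hnodup]
  omega

/-! ### The choice of parameters -/

/-- The factor `1.01` leaves room for the rounding of `q` and the error term `m / 100`. -/
theorem exists_tensorProduct_chromaticNumber_le (c : ℕ) (hc : 4 * 100 ^ 35 * 35 ^ 4 ≤ c) :
    ∃ (V W : Type) (_ : Finite V) (_ : Finite W) (G : SimpleGraph V) (H : SimpleGraph W),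
      101 * c ≤ 100 * G.chromaticNumber.toNat ∧ 101 * c ≤ 100 * H.chromaticNumber.toNat ∧
        (G.tensorProduct H).chromaticNumber ≤ (c : ℕ∞) := by
  obtain ⟨q, hq⟩ : ∃ q, q = 6 * c / 25 := ⟨_, rfl⟩
  obtain ⟨m, hm⟩ : ∃ m, m = c - 2 * q := ⟨_, rfl⟩
  have hq0 : 0 < q := by omega
  have : Nonempty (Fin q) := ⟨⟨0, hq0⟩⟩
  have hK : Fintype.card ((Bool × Fin q) ⊕ Fin m) = c := by
    simp only [Fintype.card_sum, Fintype.card_prod, Fintype.card_bool, Fintype.card_fin]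
    omega
  refine ⟨Fin 35 × Fin q, Fin 35 × Fin q → (Bool × Fin q) ⊕ Fin m, inferInstance, inferInstance,
    circulant35.cliqueBlowup (Fin q),
    (circulant35.cliqueBlowup (Fin q)).exponential ((Bool × Fin q) ⊕ Fin m), ?_, ?_, ?_⟩
  · have hcol := SimpleGraph.colorable_chromaticNumber
      (SimpleGraph.colorable_of_fintype (circulant35.cliqueBlowup (Fin q)))
    have := SimpleGraph.card_mul_card_le_of_colorable_cliqueBlowup circulant35_card_le hcol
    simp only [Fintype.card_fin] at this
    omega
  · obtain ⟨C⟩ := SimpleGraph.colorable_chromaticNumber (SimpleGraph.colorable_of_fintype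
      ((circulant35.cliqueBlowup (Fin q)).exponential ((Bool × Fin q) ⊕ Fin m)))
    generalize ENat.toNat _ = d at C ⊢
    by_contra! hd
    have hnonadj : ∀ v, ∃ x, x ≠ v ∧ ¬ circulant35.Adj v x := by
      simp only [circulant35]
      decide +kernel
    have key := SimpleGraph.lt_of_coloring_exponential_cliqueBlowup (N := 100)
      circulant35_cliqueFree hnonadj C (by
        simp only [Fintype.card_fin]
        have hm' : 13 * c ≤ 25 * m := by omega
        have hd' : d ≤ 2 * m := by omega
        have hbig : 2 * 100 ^ 35 * 35 ^ 4 < m := by omega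
        calc 100 ^ 35 * (d * 35 ^ 4) ≤ 100 ^ 35 * (2 * m * 35 ^ 4) := by gcongr
          _ = 2 * 100 ^ 35 * 35 ^ 4 * m := by ring
          _ < m * m := by
            exact Nat.mul_lt_mul_of_pos_right hbig (by omega)
          _ = m ^ 2 := (sq m).symm)
    simp only [Fintype.card_fin] at key
    omega
  · exact (SimpleGraph.chromaticNumber_tensorProduct_exponential_le _ _).trans_eq (by rw [hK])

theorem theorem1 :
    ∃ δ : ℝ, (10 : ℝ) ^ (-9 : ℤ) ≤ δ ∧
      (∃ c₀ : ℕ, ∀ c : ℕ, c₀ ≤ c →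
        ∃ (V W : Type) (_ : Finite V) (_ : Finite W) (G : SimpleGraph V) (H : SimpleGraph W),
          (1 + δ) * (c : ℝ) ≤ (G.chromaticNumber.toNat : ℝ) ∧
          (1 + δ) * (c : ℝ) ≤ (H.chromaticNumber.toNat : ℝ) ∧
          (G.tensorProduct H).chromaticNumber ≤ (c : ℕ∞)) ∧
      (∃ k₀ : ℕ, ∀ k : ℕ, k₀ ≤ k → (poljakRodl k : ℝ) ≤ (1 - δ) * (k : ℝ)) := by
  -- The loss from `1.01` to `1.001` absorbs the rounding in the choice of `c` for given `k`.
  refine ⟨1 / 1000, by norm_num, ⟨4 * 100 ^ 35 * 35 ^ 4, fun c hc => ?_⟩,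
    ⟨8 * 100 ^ 35 * 35 ^ 4, fun k hk => ?_⟩⟩
  · obtain ⟨V, W, hV, hW, G, H, hG, hH, hGH⟩ := exists_tensorProduct_chromaticNumber_le c hc
    have hG' : (101 * c : ℝ) ≤ 100 * G.chromaticNumber.toNat := by exact_mod_cast hG
    have hH' : (101 * c : ℝ) ≤ 100 * H.chromaticNumber.toNat := by exact_mod_cast hH
    have hc0 : (0 : ℝ) ≤ c := Nat.cast_nonneg c
    exact ⟨V, W, hV, hW, G, H, by linarith, by linarith, hGH⟩
  -- The second claim uses a `c` with `1.01 c ≥ k`, so that both chromatic numbers are at least `k`.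
  · obtain ⟨c, hc⟩ : ∃ c, c = 100 * k / 101 + 1 := ⟨_, rfl⟩
    obtain ⟨V, W, hV, hW, G, H, hG, hH, hGH⟩ :=
      exists_tensorProduct_chromaticNumber_le c (by omega)
    obtain ⟨m, hm⟩ := ENat.ne_top_iff_exists.1 (ne_top_of_le_ne_top (ENat.natCast_ne_top c) hGH)
    have hmc : m ≤ c := by rw [← hm] at hGH; exact_mod_cast hGH
    have hmem : m ∈ poljakRodlSet k := by
      refine ⟨V, W, hV, hW, G, H, ?_, ?_, hm.symm⟩
      · exact (Nat.cast_le.2 (by omega)).trans (ENat.natCast_toNat_le_self _)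
      · exact (Nat.cast_le.2 (by omega)).trans (ENat.natCast_toNat_le_self _)
    have hle : 1000 * poljakRodl k ≤ 999 * k := by
      have : poljakRodl k ≤ m := Nat.sInf_le hmem
      omega
    have hle' : (1000 * poljakRodl k : ℝ) ≤ 999 * k := by exact_mod_cast hle
    linarith
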